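/- Let $G$ be a locally finite simple planar graph (finite or infinite) with a fixed planar embedding, given by the clockwise cyclic order of the outgoing edges at every vertex; for example the square lattice $\mathbb Z^2$. Every vertex $u$ carries an arrow (rotor) directed to one of its $\deg(u)\ge 1$ neighbours. In one step of the rotor-router walk, the arrow at the current site of the chip is turned clockwise to the next outgoing edge, and the chip then moves along the new direction of that arrow. Let $\rho$ be a configuration of arrows in which the arrows at the vertices of a simple cycle $C_0$ with at least three edges form the directed cycle $C_0$, oriented clockwise, so that the interior of $C_0$ is on its right-hand side; assume that the interior contains only finitely many vertices. The arrows in the interior are arbitrary, and in particular may form further cycles. Let $F$ be the set of vertices strictly inside $C_0$ (not on $C_0$) from which following the arrows of $\rho$ leads to $C_0$, rather than to a cycle of arrows inside $C_0$. Start the chip at a vertex $v\in C_0$ with the arrows $\rho$. Then there is a first time $T\ge 1$ at which the chip is back at $v$ with the arrow at $v$ directed anticlockwise along $C_0$ (that is, to the predecessor of $v$ on $C_0$), and for every $v_{in}\in F$ the rotor at $v_{in}$ has performed exactly one full rotation during the first $T$ steps: it has been turned exactly $\deg(v_{in})$ times. -/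

import Mathlib

/-- A rotation system of `G`: at every vertex a cyclic order of the outgoing directed edges
(darts). `next d` is the dart that follows `d` in clockwise direction around its origin. For a
locally finite graph this is the combinatorial description of an embedding in an oriented
surface. -/
structure RotationSystem {V : Type*} (G : SimpleGraph V) where
  next : Equiv.Perm G.Dart
  next_fst : ∀ d : G.Dart, (next d).fst = d.fst
  cyclic : ∀ d e : G.Dart, d.fst = e.fst → next.SameCycle d e

/-- A state of the rotors (arrows): every site carries one of its outgoing darts. -/
structure RotorState {V : Type*} (G : SimpleGraph V) where
  dart : V → G.Dart
  dart_fst : ∀ u : V, (dart u).fst = u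

namespace RotorState

variable {V : Type*} {G : SimpleGraph V}

/-- The neighbour towards which the arrow at `u` is directed. -/
def target (ρ : RotorState G) (u : V) : V := (ρ.dart u).snd

end RotorState

namespace RotationSystem

variable {V : Type*} {G : SimpleGraph V} (R : RotationSystem G)

/-! ### Planarity -/

/-- The darts of a subgraph. -/
def SubDart (H : G.Subgraph) : Type _ := {d : G.Dart // H.Adj d.fst d.snd}

/-- One step along the boundary of a face of the subgraph `H` with the cyclic orders that it
inherits from `R`: after `d`, turn at the head of `d` to the first dart of `H` that follows the
reverse of `d` in the cyclic order. -/
def FaceStep (H : G.Subgraph) (d e : SubDart H) : Prop :=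
  ∃ k : ℕ, 0 < k ∧ (R.next ^ k) d.1.symm = e.1 ∧
    ∀ j : ℕ, 0 < j → j < k →
      ¬ H.Adj ((R.next ^ j) d.1.symm).fst ((R.next ^ j) d.1.symm).snd

/-- The number of faces of the subgraph `H` with the inherited cyclic orders: the number of
classes of the equivalence relation on darts that is generated by `FaceStep`. -/
noncomputable def numFaces (H : G.Subgraph) : ℕ := Nat.card (Quot (R.FaceStep H))

/-- The rotation system has genus zero, i.e. it is the one of an embedding in the plane (sphere):
Euler's formula `|V| - |E| + |F| = 2` holds for every finite connected subgraph that has an edge.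
(For a finite connected graph with an edge this is equivalent to Euler's formula for the graph
itself; the present form makes sense for infinite graphs.) -/
def IsPlanar : Prop :=
  ∀ H : G.Subgraph, H.verts.Finite → H.Connected → H.edgeSet.Nonempty →
    H.verts.ncard + R.numFaces H = H.edgeSet.ncard + 2

/-! ### The two sides of a directed cycle -/

/-- `d` starts at a vertex `w` of the directed cycle `C` and points to the right of `C`: in
clockwise order around `w` it lies strictly after the dart `a` along which `C` leaves `w` and
strictly before the reverse of the dart `b` along which `C` enters `w`. -/
def IsInnerDart {v : V} (C : G.Walk v v) (d : G.Dart) : Prop :=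
  ∃ a ∈ C.darts, ∃ b ∈ C.darts, b.snd = a.fst ∧
    ∃ k : ℕ, 0 < k ∧ (R.next ^ k) a = d ∧
      ∀ j : ℕ, 0 < j → j ≤ k → (R.next ^ j) a ≠ b.symm

/-- The sites off the directed cycle `C` that lie on its right-hand side (that is, inside `C` if
`C` is oriented clockwise): those that can be reached from `C` by a path that leaves `C` to the
right and does not meet `C` again. -/
inductive Inside {v : V} (C : G.Walk v v) : V → Prop
  | enter (d : G.Dart) : R.IsInnerDart C d → d.snd ∉ C.support → Inside C d.snd
  | step (u w : V) : Inside C u → G.Adj u w → w ∉ C.support → Inside C w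

/-- The arrows of `ρ` at the sites of the cycle `C` (which has at least three edges) form the
contour `C`, and `C` is clockwise: its right-hand side is the bounded side, the one that contains
only finitely many sites. -/
structure IsClockwiseContour (ρ : RotorState G) {v : V} (C : G.Walk v v) : Prop where
  isCycle : C.IsCycle
  arrows : ∀ w ∈ C.support, ρ.dart w ∈ C.darts
  finite_inside : {u : V | R.Inside C u}.Finite

/-- The sites inside `C` that belong to the forest rooted at `C`: following the arrows of `ρ`
from such a site one arrives at `C` (and not at a cycle of arrows inside `C`). -/
def forestRootedAt (ρ : RotorState G) {v : V} (C : G.Walk v v) : Set V :=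
  {u : V | R.Inside C u ∧ ∃ n : ℕ, ρ.target^[n] u ∈ C.support}

/-! ### The rotor-router walk -/

section Walk

variable [DecidableEq V]

/-- Advance the rotor at `x` to the next position in clockwise order. -/
def rotate (ρ : RotorState G) (x : V) : RotorState G where
  dart := Function.update ρ.dart x (R.next (ρ.dart x))
  dart_fst := by
    intro u
    by_cases h : u = x
    · subst h
      simp [R.next_fst, ρ.dart_fst]
    · simp [Function.update_of_ne h, ρ.dart_fst]

/-- One step of the walk on pairs (rotor state, position of the chip): the rotor at the position of
the chip is advanced, and the chip moves along the new direction of that rotor. -/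
def walkStep (s : RotorState G × V) : RotorState G × V :=
  (R.rotate s.1 s.2, (R.rotate s.1 s.2).target s.2)

/-- Rotor state and position of the chip after `t` steps of the walk started at `x`. -/
def walk (ρ : RotorState G) (x : V) (t : ℕ) : RotorState G × V := R.walkStep^[t] (ρ, x)

/-- The number of elementary rotations of the rotor at `u` during the first `T` steps. -/
def numRotations (ρ : RotorState G) (x : V) (T : ℕ) (u : V) : ℕ :=
  ((Finset.range T).filter (fun t => (R.walk ρ x t).2 = u)).card

/-- `T` is the moment at which the chip, started at the base point `v` of the clockwise contour
`C`, has returned to `v` with the rotor at `v` reversed, i.e. directed against `C`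
(anticlockwise); `T` is the first moment of this kind. -/
def IsReturnTime (ρ : RotorState G) {v : V} (C : G.Walk v v) (T : ℕ) : Prop :=
  IsLeast {t : ℕ | 0 < t ∧ (R.walk ρ v t).2 = v ∧
    ((R.walk ρ v t).1.dart v).symm ∈ C.darts} T

end Walk

end RotationSystem

/-!
The walk up to the reversal of the contour is determined by a *budget* of rotations. The rotor at a
site `u` strictly inside `C` gets the budget `deg u`; the rotor at a site of `C` gets the number of
turns that lead clockwise from its direction along `C`, through the darts to the right of `C`, to
the dart that points back along `C`. The sites of `C` and inside it form a finite set `S`.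

The set of darts that the budget allows has two properties. It never leads out of `S`, and the
darts among them that enter a site `x` number at most the budget of `x`: their reverses are, in
clockwise order at `x`, the initial direction of the rotor and its successors, without the last dart
of the budget. For a site on `C` this says that a dart that joins `C` to its inside, or a chord,
lies on the right of `C` at all its ends on `C`. This is a Jordan curve theorem
(`RotationSystem.IsEar.isInnerDart`), proved from Euler's formula: a cycle together with an ear that
leaves it to the right and returns from the left has more edges than vertices but at most two
faces.

Consider the first moment `T` at which the chip stands at a site `x` whose budget is used up. The
site has been left as often as its budget says and entered at most as often, so the chip must have
started there: `x = v`, and the rotor at `v` points against `C`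
(`RotationSystem.IsBudget.exists_exhaustion`). Since `T` is bounded by the sum of the budgets, it
exists. At time `T` every site whose budget is used up has been entered along all darts that the
budget allows. For a site of `C` one of these comes from the next site of `C` and is the last dart
of the budget there, so going round from `v` all rotors on `C` have used up their budgets. For a
site inside `C` whose arrow points to `w`, this arrow is the last dart of a full turn, so a full
budget at `w` implies a full turn at the site; hence all sites of the forest rooted at `C` have made
exactly one full turn.
-/

/-! ### The cyclic order of the darts at a vertex -/

namespace RotationSystem

variable {V : Type*} {G : SimpleGraph V} (R : RotationSystem G)

lemma pow_next_fst (k : ℕ) (d : G.Dart) : ((R.next ^ k) d).fst = d.fst := by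
  induction k with
  | zero => rfl
  | succ k ih => rw [pow_succ', Equiv.Perm.mul_apply, R.next_fst, ih]

section LocallyFinite

variable [G.LocallyFinite]

lemma dart_mem_periodicPts (d : G.Dart) : d ∈ Function.periodicPts R.next := by
  have hni : ¬ Function.Injective (fun k : ℕ =>
      (⟨((R.next ^ k) d).snd, by
        have := ((R.next ^ k) d).adj
        rwa [R.pow_next_fst] at this⟩ : G.neighborSet d.fst)) :=
    not_injective_infinite_finite _
  simp only [Function.Injective, not_forall] at hni
  obtain ⟨i, j, hij, hne⟩ := hni
  have hd : (R.next ^ i) d = (R.next ^ j) d :=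
    SimpleGraph.Dart.ext _ _ (Prod.ext (by rw [R.pow_next_fst, R.pow_next_fst])
      (congrArg Subtype.val hij))
  rw [Equiv.Perm.coe_pow, Equiv.Perm.coe_pow] at hd
  rcases Nat.lt_or_gt_of_ne hne with h | h
  · exact Function.mk_mem_periodicPts (Nat.sub_pos_of_lt h)
      (Function.iterate_cancel R.next.injective hd.symm)
  · exact Function.mk_mem_periodicPts (Nat.sub_pos_of_lt h)
      (Function.iterate_cancel R.next.injective hd)

lemma exists_pow_lt_minimalPeriod {d e : G.Dart} (h : d.fst = e.fst) :
    ∃ i < Function.minimalPeriod R.next d, (R.next ^ i) d = e := by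
  have hpos := Function.minimalPeriod_pos_of_mem_periodicPts (R.dart_mem_periodicPts d)
  obtain ⟨z, hz⟩ := R.cyclic d e h
  have hper : (R.next ^ (Function.minimalPeriod R.next d : ℤ)) d = d := by
    rw [zpow_natCast, Equiv.Perm.coe_pow, Function.iterate_minimalPeriod]
  have hnn := Int.emod_nonneg z (b := (Function.minimalPeriod R.next d : ℤ)) (by omega)
  refine ⟨(z % (Function.minimalPeriod R.next d : ℤ)).toNat, ?_, ?_⟩
  · have := Int.emod_lt_of_pos z (b := (Function.minimalPeriod R.next d : ℤ)) (by omega)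
    omega
  · rw [← zpow_natCast, Int.toNat_of_nonneg hnn, ← hz]
    conv_rhs => rw [← Int.emod_add_mul_ediv z (Function.minimalPeriod R.next d : ℤ)]
    rw [zpow_add, Equiv.Perm.mul_apply, zpow_mul]
    congr 1
    exact (Equiv.Perm.zpow_apply_eq_self_of_apply_eq_self hper _).symm

lemma minimalPeriod_next (d : G.Dart) :
    Function.minimalPeriod R.next d = G.degree d.fst := by
  rw [← SimpleGraph.card_neighborFinset_eq_degree, ← Finset.card_range
    (Function.minimalPeriod R.next d)]
  refine Finset.card_bij (fun i _ => ((R.next ^ i) d).snd) ?_ ?_ ?_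
  · intro i _
    rw [SimpleGraph.mem_neighborFinset]
    have := ((R.next ^ i) d).adj
    rwa [R.pow_next_fst] at this
  · intro i hi j hj hij
    have hd : (R.next ^ i) d = (R.next ^ j) d :=
      SimpleGraph.Dart.ext _ _ (Prod.ext (by rw [R.pow_next_fst, R.pow_next_fst]) hij)
    rw [Equiv.Perm.coe_pow, Equiv.Perm.coe_pow] at hd
    exact Function.iterate_injOn_Iio_minimalPeriod (Finset.mem_range.1 hi)
      (Finset.mem_range.1 hj) hd
  · intro y hy
    rw [SimpleGraph.mem_neighborFinset] at hy
    obtain ⟨i, hi, hi'⟩ := R.exists_pow_lt_minimalPeriod (d := d) (e := ⟨(d.fst, y), hy⟩) rfl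
    exact ⟨i, Finset.mem_range.2 hi, by rw [hi']⟩

/-- Turning clockwise from `d`, one meets every dart at the same vertex within one turn. -/
lemma exists_pow_lt_degree {d e : G.Dart} (h : d.fst = e.fst) :
    ∃ i < G.degree d.fst, (R.next ^ i) d = e := by
  rw [← R.minimalPeriod_next]
  exact R.exists_pow_lt_minimalPeriod h

lemma pow_degree (d : G.Dart) : (R.next ^ G.degree d.fst) d = d := by
  rw [← R.minimalPeriod_next, Equiv.Perm.coe_pow, Function.iterate_minimalPeriod]

lemma pow_next_inj {d : G.Dart} {i j : ℕ} (hi : i < G.degree d.fst) (hj : j < G.degree d.fst)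
    (h : (R.next ^ i) d = (R.next ^ j) d) : i = j := by
  rw [← R.minimalPeriod_next] at hi hj
  rw [Equiv.Perm.coe_pow, Equiv.Perm.coe_pow] at h
  exact Function.iterate_injOn_Iio_minimalPeriod hi hj h

/-- The indices `1, …, deg` also number the darts at a vertex without repetition. -/
lemma pow_next_inj' {d : G.Dart} {i j : ℕ} (hi0 : 0 < i) (hj0 : 0 < j)
    (hi : i ≤ G.degree d.fst) (hj : j ≤ G.degree d.fst)
    (h : (R.next ^ i) d = (R.next ^ j) d) : i = j := by
  obtain ⟨i, rfl⟩ := Nat.exists_eq_succ_of_ne_zero hi0.ne'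
  obtain ⟨j, rfl⟩ := Nat.exists_eq_succ_of_ne_zero hj0.ne'
  simp only [Nat.succ_eq_add_one, pow_succ', Equiv.Perm.mul_apply, EmbeddingLike.apply_eq_iff_eq]
    at h
  rw [R.pow_next_inj hi hj h]

end LocallyFinite

end RotationSystem

/-! ### Counting arrivals and departures -/

namespace RotationSystem

variable {V : Type*} {G : SimpleGraph V} (R : RotationSystem G)

section Walk

variable [DecidableEq V]

/-- The dart along which the chip moves in step `t + 1`. -/
def stepDart (ρ : RotorState G) (v : V) (t : ℕ) : G.Dart :=
  (R.walk ρ v (t + 1)).1.dart (R.walk ρ v t).2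

/-- The number of steps among the first `t` that end at `x`. -/
def numArrivals (ρ : RotorState G) (v : V) (t : ℕ) (x : V) : ℕ :=
  ((Finset.range t).filter (fun s => (R.walk ρ v (s + 1)).2 = x)).card

variable (ρ : RotorState G) (v : V)

lemma walk_succ (t : ℕ) : R.walk ρ v (t + 1) = R.walkStep (R.walk ρ v t) :=
  Function.iterate_succ_apply' _ _ _

lemma numRotations_succ (t : ℕ) (u : V) : R.numRotations ρ v (t + 1) u =
    R.numRotations ρ v t u + if (R.walk ρ v t).2 = u then 1 else 0 := by
  unfold numRotations
  rw [Finset.range_add_one, Finset.filter_insert]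
  split_ifs with h
  · rw [Finset.card_insert_of_notMem (by simp)]
  · rfl

lemma numRotations_mono (u : V) : Monotone (fun t => R.numRotations ρ v t u) :=
  monotone_nat_of_le_succ fun t => by
    rw [numRotations_succ]
    exact Nat.le_add_right _ _

lemma numArrivals_succ (t : ℕ) (x : V) : R.numArrivals ρ v (t + 1) x =
    R.numArrivals ρ v t x + if (R.walk ρ v (t + 1)).2 = x then 1 else 0 := by
  unfold numArrivals
  rw [Finset.range_add_one, Finset.filter_insert]
  split_ifs with h
  · rw [Finset.card_insert_of_notMem (by simp)]
  · rfl

/-- Conservation of the chip: arrivals and departures at `x` balance, up to its start and its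
present position. -/
lemma numArrivals_add (t : ℕ) (x : V) :
    R.numArrivals ρ v t x + (if v = x then 1 else 0) =
      R.numRotations ρ v t x + if (R.walk ρ v t).2 = x then 1 else 0 := by
  induction t with
  | zero => rfl
  | succ t ih => rw [numArrivals_succ, numRotations_succ]; omega

/-- The rotor at `u` depends only on how often it has been turned. -/
lemma walk_dart (t : ℕ) (u : V) : (R.walk ρ v t).1.dart u =
    (R.next ^ R.numRotations ρ v t u) (ρ.dart u) := by
  induction t with
  | zero => rfl
  | succ t ih =>
    rw [walk_succ, numRotations_succ]
    simp only [walkStep, rotate]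
    split_ifs with h
    · rw [h, Function.update_self, ih, pow_succ', Equiv.Perm.mul_apply]
    · rw [Function.update_of_ne (Ne.symm h), ih, add_zero]

lemma stepDart_eq (t : ℕ) : R.stepDart ρ v t =
    (R.next ^ (R.numRotations ρ v t (R.walk ρ v t).2 + 1)) (ρ.dart (R.walk ρ v t).2) := by
  rw [stepDart, walk_dart, numRotations_succ, if_pos rfl]

lemma stepDart_fst (t : ℕ) : (R.stepDart ρ v t).fst = (R.walk ρ v t).2 := by
  rw [stepDart_eq, R.pow_next_fst, ρ.dart_fst]

lemma stepDart_snd (t : ℕ) : (R.stepDart ρ v t).snd = (R.walk ρ v (t + 1)).2 := by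
  rw [stepDart, walk_succ]
  rfl

lemma sum_numRotations (S : Finset V) (t : ℕ) (h : ∀ s < t, (R.walk ρ v s).2 ∈ S) :
    ∑ u ∈ S, R.numRotations ρ v t u = t := by
  unfold numRotations
  rw [← Finset.card_eq_sum_card_fiberwise (s := Finset.range t)
    (f := fun s => (R.walk ρ v s).2), Finset.card_range]
  intro s hs
  exact h s (by simpa using hs)

end Walk

/-- A budget of rotations for the walk on the finite set `S`: if every rotor `u ∈ S` is turned at
most `N u` times, then the chip stays in `S`, and it enters each `x ∈ S` only along the reverses of
the `N x` darts that start with `ρ.dart x` in clockwise order. -/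
structure IsBudget [G.LocallyFinite] (ρ : RotorState G) (S : Finset V) (N : V → ℕ) : Prop where
  le_degree : ∀ u ∈ S, N u ≤ G.degree u
  snd_mem : ∀ u ∈ S, ∀ j, 0 < j → j ≤ N u → ((R.next ^ j) (ρ.dart u)).snd ∈ S
  symm_eq : ∀ u ∈ S, ∀ j, 0 < j → j ≤ N u → ∃ i < N ((R.next ^ j) (ρ.dart u)).snd,
    (R.next ^ i) (ρ.dart ((R.next ^ j) (ρ.dart u)).snd) = ((R.next ^ j) (ρ.dart u)).symm

namespace IsBudget

variable {R}
variable [DecidableEq V] {ρ : RotorState G} {S : Finset V} {N : V → ℕ}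
  {v : V}

lemma numRotations_le {t : ℕ}
    (ht : ∀ s < t, R.numRotations ρ v s (R.walk ρ v s).2 < N (R.walk ρ v s).2) (u : V) :
    R.numRotations ρ v t u ≤ N u := by
  induction t with
  | zero => simp [numRotations]
  | succ t ih =>
    have h1 := ih fun s hs => ht s (hs.trans (Nat.lt_succ_self t))
    have h2 := ht t (Nat.lt_succ_self t)
    rw [numRotations_succ]
    split_ifs with h
    · rw [h] at h2
      exact h2
    · exact h1

variable [G.LocallyFinite]

lemma walk_mem (hN : R.IsBudget ρ S N) (hv : v ∈ S) {t : ℕ}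
    (ht : ∀ s < t, R.numRotations ρ v s (R.walk ρ v s).2 < N (R.walk ρ v s).2) :
    (R.walk ρ v t).2 ∈ S := by
  induction t with
  | zero => exact hv
  | succ t ih =>
    have hmem := ih fun s hs => ht s (hs.trans (Nat.lt_succ_self t))
    rw [← stepDart_snd, stepDart_eq]
    exact hN.snd_mem _ hmem _ (Nat.succ_pos _) (ht t (Nat.lt_succ_self t))

/-- No dart is used twice as long as the budget is respected. -/
lemma stepDart_injOn (hN : R.IsBudget ρ S N) (hv : v ∈ S) {t : ℕ}
    (ht : ∀ s < t, R.numRotations ρ v s (R.walk ρ v s).2 < N (R.walk ρ v s).2) :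
    Set.InjOn (R.stepDart ρ v) (Set.Iio t) := by
  have key : ∀ s s', s < s' → s' < t → R.stepDart ρ v s ≠ R.stepDart ρ v s' := by
    intro s s' hss hs' h
    have hpos : (R.walk ρ v s).2 = (R.walk ρ v s').2 := by
      rw [← stepDart_fst, h, stepDart_fst]
    have hmem := hN.walk_mem hv fun r hr => ht r (hr.trans (hss.trans hs'))
    have h1 := ht s (hss.trans hs')
    have h2 := ht s' hs'
    have hle := hN.le_degree _ hmem
    rw [stepDart_eq, stepDart_eq, ← hpos] at h
    rw [← hpos] at h2
    have heq := R.pow_next_inj' (Nat.succ_pos _) (Nat.succ_pos _)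
      (by rw [ρ.dart_fst]; omega) (by rw [ρ.dart_fst]; omega) h
    have hmono := R.numRotations_mono ρ v (R.walk ρ v s).2 (Nat.succ_le_of_lt hss)
    simp only [Nat.succ_eq_add_one, numRotations_succ, if_true] at hmono
    omega
  intro s hs s' hs' h
  rcases lt_trichotomy s s' with hlt | heq | hlt
  · exact absurd h (key s s' hlt hs')
  · exact heq
  · exact absurd h.symm (key s' s hlt hs)

/-- The chip enters `x` only along the reverses of the first `N x` darts at `x`, counted clockwise
from the initial direction of its rotor. -/
lemma image_stepDart_subset (hN : R.IsBudget ρ S N) (hv : v ∈ S) {t : ℕ}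
    (ht : ∀ s < t, R.numRotations ρ v s (R.walk ρ v s).2 < N (R.walk ρ v s).2) (x : V) :
    ((Finset.range t).filter (fun s => (R.walk ρ v (s + 1)).2 = x)).image (R.stepDart ρ v) ⊆
      (Finset.range (N x)).image (fun i => ((R.next ^ i) (ρ.dart x)).symm) := by
  intro e he
  obtain ⟨s, hs, rfl⟩ := Finset.mem_image.1 he
  obtain ⟨hst, rfl⟩ := Finset.mem_filter.1 hs
  rw [Finset.mem_range] at hst
  have hmem := hN.walk_mem hv fun r hr => ht r (hr.trans hst)
  obtain ⟨i, hi, hi'⟩ := hN.symm_eq _ hmem _ (Nat.succ_pos _) (ht s hst)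
  rw [Nat.succ_eq_add_one, ← stepDart_eq, stepDart_snd] at hi hi'
  exact Finset.mem_image.2 ⟨i, Finset.mem_range.2 hi, by rw [hi', SimpleGraph.Dart.symm_symm]⟩

lemma card_image_stepDart (hN : R.IsBudget ρ S N) (hv : v ∈ S) {t : ℕ}
    (ht : ∀ s < t, R.numRotations ρ v s (R.walk ρ v s).2 < N (R.walk ρ v s).2) (x : V) :
    (((Finset.range t).filter (fun s => (R.walk ρ v (s + 1)).2 = x)).image
      (R.stepDart ρ v)).card = R.numArrivals ρ v t x :=
  Finset.card_image_of_injOn fun _ hs _ hs' h =>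
    hN.stepDart_injOn hv ht (Finset.mem_range.1 (Finset.mem_filter.1 hs).1)
      (Finset.mem_range.1 (Finset.mem_filter.1 hs').1) h

lemma numArrivals_le (hN : R.IsBudget ρ S N) (hv : v ∈ S) {t : ℕ}
    (ht : ∀ s < t, R.numRotations ρ v s (R.walk ρ v s).2 < N (R.walk ρ v s).2) (x : V) :
    R.numArrivals ρ v t x ≤ N x := by
  rw [← hN.card_image_stepDart hv ht]
  refine (Finset.card_le_card (hN.image_stepDart_subset hv ht x)).trans ?_
  exact Finset.card_image_le.trans (Finset.card_range _).le

/-- A site that was entered as often as the budget allows was entered along every dart that the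
budget allows. -/
lemma exists_departure_of_numArrivals_eq (hN : R.IsBudget ρ S N) (hv : v ∈ S) {t : ℕ}
    (ht : ∀ s < t, R.numRotations ρ v s (R.walk ρ v s).2 < N (R.walk ρ v s).2) {x : V}
    (hx : R.numArrivals ρ v t x = N x) {i : ℕ} (hi : i < N x) :
    ∃ j, 0 < j ∧ j ≤ R.numRotations ρ v t ((R.next ^ i) (ρ.dart x)).snd ∧
      (R.next ^ j) (ρ.dart ((R.next ^ i) (ρ.dart x)).snd) = ((R.next ^ i) (ρ.dart x)).symm := by
  have heq := Finset.eq_of_subset_of_card_le (hN.image_stepDart_subset hv ht x) (by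
    rw [hN.card_image_stepDart hv ht, hx]
    exact Finset.card_image_le.trans (Finset.card_range _).le)
  have hmem := Finset.mem_image_of_mem (fun i => ((R.next ^ i) (ρ.dart x)).symm)
    (Finset.mem_range.2 hi)
  rw [← heq] at hmem
  obtain ⟨s, hs, hs'⟩ := Finset.mem_image.1 hmem
  have hst := Finset.mem_range.1 (Finset.mem_filter.1 hs).1
  have hfst : (R.walk ρ v s).2 = ((R.next ^ i) (ρ.dart x)).snd := by
    rw [← stepDart_fst, hs']
    rfl
  rw [← hs', stepDart_eq, hfst]
  refine ⟨_, Nat.succ_pos _, ?_, rfl⟩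
  have hmono := R.numRotations_mono ρ v ((R.next ^ i) (ρ.dart x)).snd (Nat.succ_le_of_lt hst)
  simpa only [Nat.succ_eq_add_one, numRotations_succ, hfst, if_true] using hmono

/-- The walk uses up the budget of some site after finitely many steps. When the chip first stands
at a site `x` whose budget is used up, `x` has been left `N x` times and entered at most `N x`
times, so that `x` is the starting point. -/
theorem exists_exhaustion (hN : R.IsBudget ρ S N) (hv : v ∈ S) :
    ∃ T, (R.walk ρ v T).2 = v ∧ R.numRotations ρ v T v = N v ∧
      (∀ s < T, R.numRotations ρ v s (R.walk ρ v s).2 < N (R.walk ρ v s).2) ∧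
      (∀ u, R.numRotations ρ v T u ≤ N u) ∧
      ∀ x, R.numRotations ρ v T x = N x → ∀ i < N x,
        ∃ j, 0 < j ∧ j ≤ R.numRotations ρ v T ((R.next ^ i) (ρ.dart x)).snd ∧
          (R.next ^ j) (ρ.dart ((R.next ^ i) (ρ.dart x)).snd) =
            ((R.next ^ i) (ρ.dart x)).symm := by
  have hex : ∃ t, N (R.walk ρ v t).2 ≤ R.numRotations ρ v t (R.walk ρ v t).2 := by
    by_contra! hlt
    -- otherwise the number of steps never exceeds the total budget
    have h1 := R.sum_numRotations ρ v S (∑ u ∈ S, N u + 1)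
      fun s _ => hN.walk_mem hv fun r _ => hlt r
    have h2 : ∑ u ∈ S, R.numRotations ρ v (∑ u ∈ S, N u + 1) u ≤ ∑ u ∈ S, N u :=
      Finset.sum_le_sum fun u _ => numRotations_le (fun r _ => hlt r) u
    omega
  have hT := Nat.find_spec hex
  have hlt : ∀ s < Nat.find hex, R.numRotations ρ v s (R.walk ρ v s).2 < N (R.walk ρ v s).2 :=
    fun s hs => not_le.1 (Nat.find_min hex hs)
  generalize Nat.find hex = T at hT hlt
  have hle := numRotations_le (R := R) hlt
  have hpos : (R.walk ρ v T).2 = v := by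
    by_contra hne
    have h1 := R.numArrivals_add ρ v T (R.walk ρ v T).2
    have h2 := hN.numArrivals_le hv hlt (R.walk ρ v T).2
    rw [if_neg (Ne.symm hne), if_pos rfl] at h1
    omega
  refine ⟨T, hpos, le_antisymm (hle v) (by rwa [hpos] at hT), hlt, hle, fun x hx i hi => ?_⟩
  refine hN.exists_departure_of_numArrivals_eq hv hlt ?_ hi
  have h1 := R.numArrivals_add ρ v T x
  rw [hpos] at h1
  omega

end IsBudget

end RotationSystem

/-! ### Darts of walks and cycles -/

namespace SimpleGraph.Walk

variable {V : Type*} {G : SimpleGraph V}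

/-- A property of sites that passes from one end of each dart of a walk to the other holds along
the walk if it holds at its start. -/
lemma forall_mem_support_of_step {u w : V} (W : G.Walk u w) {Q : V → Prop} (h0 : Q u)
    (hs : ∀ d ∈ W.darts, Q d.fst → Q d.snd) : ∀ x ∈ W.support, Q x := by
  induction W with
  | nil =>
    intro x hx
    rw [support_nil, List.mem_singleton] at hx
    exact hx ▸ h0
  | cons h W ih =>
    intro x hx
    rw [support_cons, List.mem_cons] at hx
    rcases hx with rfl | hx
    · exact h0
    · refine ih (hs ⟨(_, _), h⟩ (by simp) h0) (fun d hd => hs d ?_) x hx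
      rw [darts_cons]
      exact List.mem_cons_of_mem _ hd

lemma forall_mem_darts_of_step {u w : V} (W : G.Walk u w) {Q : G.Dart → Prop}
    (h0 : ∀ d ∈ W.darts, d.fst = u → Q d)
    (hs : ∀ d ∈ W.darts, ∀ e ∈ W.darts, d.snd = e.fst → Q d → Q e) :
    ∀ d ∈ W.darts, Q d := fun d hd =>
  W.forall_mem_support_of_step (Q := fun x => ∀ d ∈ W.darts, d.fst = x → Q d) h0
    (fun d hd hQ e he hde => hs d hd e he hde.symm (hQ d hd rfl))
    d.fst (W.dart_fst_mem_support_of_mem_darts hd) d hd rfl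

lemma edge_mem_edges_iff {u w : V} {W : G.Walk u w} {d : G.Dart} :
    d.edge ∈ W.edges ↔ d ∈ W.darts ∨ d.symm ∈ W.darts := by
  rw [edges, List.mem_map]
  constructor
  · rintro ⟨e, he, hde⟩
    rcases dart_edge_eq_iff _ _ |>.1 hde with rfl | rfl
    · exact Or.inl he
    · exact Or.inr (by simpa using he)
  · rintro (h | h)
    · exact ⟨d, h, rfl⟩
    · exact ⟨_, h, d.edge_symm⟩

lemma symm_notMem_darts {u w : V} {W : G.Walk u w} (hW : W.edges.Nodup) {d : G.Dart}
    (hd : d ∈ W.darts) : d.symm ∉ W.darts := fun hd' =>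
  d.symm_ne (List.inj_on_of_nodup_map hW hd' hd d.edge_symm)

namespace IsCycle

variable {v : V} {C : G.Walk v v}

lemma nodup_map_fst (hC : C.IsCycle) : (C.darts.map (·.fst)).Nodup := by
  rw [map_fst_darts]
  exact hC.nodup_dropLast_support

lemma nodup_map_snd (hC : C.IsCycle) : (C.darts.map (·.snd)).Nodup := by
  rw [map_snd_darts]
  exact hC.support_nodup

lemma dart_eq_of_fst (hC : C.IsCycle) {d e : G.Dart} (hd : d ∈ C.darts) (he : e ∈ C.darts)
    (h : d.fst = e.fst) : d = e :=
  List.inj_on_of_nodup_map hC.nodup_map_fst hd he h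

lemma dart_eq_of_snd (hC : C.IsCycle) {d e : G.Dart} (hd : d ∈ C.darts) (he : e ∈ C.darts)
    (h : d.snd = e.snd) : d = e :=
  List.inj_on_of_nodup_map hC.nodup_map_snd hd he h

lemma exists_dart_snd (hC : C.IsCycle) {x : V} (hx : x ∈ C.support) :
    ∃ b ∈ C.darts, b.snd = x := by
  have hx' : x ∈ C.support.tail := by
    rcases C.mem_support_iff.1 hx with rfl | h
    · exact end_mem_tail_support hC.not_nil
    · exact h
  rw [← map_snd_darts] at hx'
  exact List.mem_map.1 hx'

lemma exists_dart_fst (hC : C.IsCycle) {x : V} (hx : x ∈ C.support) :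
    ∃ a ∈ C.darts, a.fst = x := by
  obtain ⟨b, hb, rfl⟩ := hC.reverse.exists_dart_snd (x := x) (by simpa using hx)
  exact ⟨b.symm, mem_darts_reverse.1 hb, rfl⟩

end IsCycle

end SimpleGraph.Walk

namespace RotationSystem

variable {V : Type*} {G : SimpleGraph V} (R : RotationSystem G)

/-- Numbering the darts at a vertex of the cycle `C` clockwise, starting from the dart along which
`C` leaves it, the inner darts are those before the dart that points back along `C`. -/
lemma isInnerDart_iff [G.LocallyFinite] {v : V} {C : G.Walk v v} (hC : C.IsCycle)
    {a b d : G.Dart} (ha : a ∈ C.darts) (hb : b ∈ C.darts) (hba : b.snd = a.fst) {k i : ℕ}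
    (hk : k < G.degree a.fst) (hkb : (R.next ^ k) a = b.symm) (hi : i < G.degree a.fst)
    (hid : (R.next ^ i) a = d) : R.IsInnerDart C d ↔ 0 < i ∧ i < k := by
  have hk0 : 0 < k := by
    refine Nat.pos_of_ne_zero fun h => ?_
    subst h
    exact SimpleGraph.Walk.symm_notMem_darts hC.edges_nodup hb (hkb ▸ ha)
  constructor
  · rintro ⟨a', ha', b', hb', hba', m, hm, hmd, hlt⟩
    have haa : a' = a := hC.dart_eq_of_fst ha' ha (by
      rw [← R.pow_next_fst m a', hmd, ← hid, R.pow_next_fst])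
    subst haa
    have hbb : b' = b := hC.dart_eq_of_snd hb' hb (hba'.trans hba.symm)
    subst hbb
    have hmk : m < k := by
      by_contra! h
      exact hlt k hk0 h hkb
    have := R.pow_next_inj hi (hmk.trans hk) (hid.trans hmd.symm)
    omega
  · rintro ⟨hi0, hik⟩
    refine ⟨a, ha, b, hb, hba, i, hi0, hid, fun j _ hji h => ?_⟩
    have := R.pow_next_inj (hji.trans_lt hi) hk (h.trans hkb.symm)
    omega

lemma IsInnerDart.fst_mem {R : RotationSystem G} {v : V} {C : G.Walk v v} {d : G.Dart}
    (hd : R.IsInnerDart C d) : d.fst ∈ C.support := by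
  obtain ⟨a, ha, _, _, _, m, _, rfl, _⟩ := hd
  rw [R.pow_next_fst]
  exact C.dart_fst_mem_support_of_mem_darts ha

/-- Inner darts do not lie along the cycle. -/
lemma IsInnerDart.edge_notMem [G.LocallyFinite] {R : RotationSystem G} {v : V} {C : G.Walk v v}
    (hC : C.IsCycle) {d : G.Dart} (hd : R.IsInnerDart C d) : d.edge ∉ C.edges := by
  obtain ⟨a, ha, haf⟩ := hC.exists_dart_fst hd.fst_mem
  obtain ⟨b, hb, hbs⟩ := hC.exists_dart_snd hd.fst_mem
  obtain ⟨k, hk, hkb⟩ := R.exists_pow_lt_degree (d := a) (e := b.symm) (haf.trans hbs.symm)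
  obtain ⟨i, hi, hid⟩ := R.exists_pow_lt_degree haf
  have hik := (R.isInnerDart_iff hC ha hb (hbs.trans haf.symm) hk hkb hi hid).1 hd
  intro he
  rcases SimpleGraph.Walk.edge_mem_edges_iff.1 he with h | h
  · have : (R.next ^ i) a = (R.next ^ 0) a := hid.trans (hC.dart_eq_of_fst h ha haf.symm)
    have := R.pow_next_inj hi (by omega) this
    omega
  · have hdb : d.symm = b := hC.dart_eq_of_snd h hb hbs.symm
    have : (R.next ^ i) a = (R.next ^ k) a := by
      rw [hid, hkb, ← hdb, SimpleGraph.Dart.symm_symm]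
    have := R.pow_next_inj hi hk this
    omega

/-! ### Ears of a cycle: a combinatorial Jordan curve theorem -/

/-- The walk `P` is an ear of the cycle `C`: a path between two sites of `C`, or a cycle through
one site of `C`, that is otherwise disjoint from `C`. The first dart of `P` is `p`, and `q` is the
reverse of its last dart; so both `p` and `q` leave `C`. -/
structure IsEar {v w₁ w₂ : V} (C : G.Walk v v) (P : G.Walk w₁ w₂) (p q : G.Dart) : Prop where
  start_mem : w₁ ∈ C.support
  end_mem : w₂ ∈ C.support
  p_mem : p ∈ P.darts
  q_mem : q.symm ∈ P.darts
  p_fst : p.fst = w₁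
  q_fst : q.fst = w₂
  eq_p : ∀ d ∈ P.darts, d.fst ∈ C.support → d = p
  eq_q : ∀ d ∈ P.darts, d.snd ∈ C.support → d.symm = q
  nodup_fst : (P.darts.map (·.fst)).Nodup
  nodup_snd : (P.darts.map (·.snd)).Nodup
  edges_nodup : P.edges.Nodup
  edges_disjoint : ∀ e ∈ P.edges, e ∉ C.edges

/-- Darts `d` and `e` of `H` lie on the same face if no dart of `H` is strictly between the reverse
of `d` and `e` in clockwise order. The indices refer to an arbitrary dart `a` at the same vertex. -/
lemma quot_mk_eq_of_pow {H : G.Subgraph} {a d e : G.Dart} {i j : ℕ} (hij : i < j)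
    (hi : (R.next ^ i) a = d.symm) (hj : (R.next ^ j) a = e)
    (hm : ∀ m, i < m → m < j → ¬ H.Adj ((R.next ^ m) a).fst ((R.next ^ m) a).snd)
    (hd : H.Adj d.fst d.snd) (he : H.Adj e.fst e.snd) :
    Quot.mk (R.FaceStep H) ⟨d, hd⟩ = Quot.mk (R.FaceStep H) ⟨e, he⟩ := by
  have hpow : ∀ m, (R.next ^ m) d.symm = (R.next ^ (m + i)) a := fun m => by
    rw [pow_add, Equiv.Perm.mul_apply, hi]
  refine Quot.sound ⟨j - i, Nat.sub_pos_of_lt hij, ?_, fun m hm0 hmj => ?_⟩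
  · rw [hpow, Nat.sub_add_cancel hij.le, hj]
  · rw [hpow]
    exact hm _ (by omega) (by omega)

namespace IsEar

variable {R} {v w₁ w₂ : V} {C : G.Walk v v} {P : G.Walk w₁ w₂} {p q : G.Dart}

/-- The darts of the union of the cycle and the ear. -/
lemma adj_iff {d : G.Dart} : (C.toSubgraph ⊔ P.toSubgraph).Adj d.fst d.snd ↔
    (d ∈ C.darts ∨ d.symm ∈ C.darts) ∨ d ∈ P.darts ∨ d.symm ∈ P.darts := by
  rw [← SimpleGraph.Walk.edge_mem_edges_iff, ← SimpleGraph.Walk.edge_mem_edges_iff,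
    SimpleGraph.Subgraph.sup_adj, ← SimpleGraph.Walk.mem_edges_toSubgraph,
    ← SimpleGraph.Walk.mem_edges_toSubgraph]
  rfl

/-- At an interior site of the ear there are only the two darts of the ear. -/
lemma index_cases_interior (h : IsEar C P p q) {d e a : G.Dart} (hd : d ∈ P.darts)
    (he : e ∈ P.darts) (hde : d.snd = e.fst) (hx : e.fst ∉ C.support) (haf : a.fst = e.fst)
    (m : ℕ) (hadj : (C.toSubgraph ⊔ P.toSubgraph).Adj
      ((R.next ^ m) a).fst ((R.next ^ m) a).snd) :
    (R.next ^ m) a = e ∨ (R.next ^ m) a = d.symm := by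
  have hfst := (R.pow_next_fst m a).trans haf
  rcases adj_iff.1 hadj with (h1 | h1) | h1 | h1
  · exact absurd (hfst ▸ C.dart_fst_mem_support_of_mem_darts h1) hx
  · exact absurd (hfst ▸ C.dart_snd_mem_support_of_mem_darts h1) hx
  · exact Or.inl (List.inj_on_of_nodup_map h.nodup_fst h1 he hfst)
  · right
    have : ((R.next ^ m) a).symm = d :=
      List.inj_on_of_nodup_map h.nodup_snd h1 hd (hfst.trans hde.symm)
    rw [← this, SimpleGraph.Dart.symm_symm]

section

variable [G.LocallyFinite]

/-- The position of the darts of `C` and of an ear in the cyclic order at a vertex of `C`, if the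
ear leaves `C` to the right but does not return from the right. -/
lemma index_cases (h : IsEar C P p q) (hC : C.IsCycle) (hp : R.IsInnerDart C p)
    (hq : ¬ R.IsInnerDart C q) {a b : G.Dart} (ha : a ∈ C.darts) (hb : b ∈ C.darts)
    (hba : b.snd = a.fst) {k m : ℕ} (hk : k < G.degree a.fst) (hkb : (R.next ^ k) a = b.symm)
    (hm : m < G.degree a.fst) (hadj : (C.toSubgraph ⊔ P.toSubgraph).Adj
      ((R.next ^ m) a).fst ((R.next ^ m) a).snd) :
    m = 0 ∨ m = k ∨ ((R.next ^ m) a = p ∧ 0 < m ∧ m < k) ∨ ((R.next ^ m) a = q ∧ k < m) := by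
  have hfst := R.pow_next_fst m a
  have haC := C.dart_fst_mem_support_of_mem_darts ha
  rcases adj_iff.1 hadj with (h1 | h1) | h1 | h1
  · exact Or.inl (R.pow_next_inj hm (by omega) (hC.dart_eq_of_fst h1 ha hfst))
  · refine Or.inr (Or.inl (R.pow_next_inj hm hk ?_))
    have := hC.dart_eq_of_snd h1 hb (hfst.trans hba.symm)
    rw [hkb, ← this, SimpleGraph.Dart.symm_symm]
  · have hmp := h.eq_p _ h1 (by rwa [hfst])
    have := (R.isInnerDart_iff hC ha hb hba hk hkb hm hmp).1 hp
    exact Or.inr (Or.inr (Or.inl ⟨hmp, this⟩))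
  · have hmq := h.eq_q _ h1 (by change ((R.next ^ m) a).fst ∈ _; rwa [hfst])
    rw [SimpleGraph.Dart.symm_symm] at hmq
    have hnot := mt (R.isInnerDart_iff hC ha hb hba hk hkb hm hmq).2 hq
    have hqe : q.edge ∉ C.edges := h.edges_disjoint _
      (SimpleGraph.Walk.edge_mem_edges_iff.2 (Or.inr h.q_mem))
    rw [SimpleGraph.Walk.edge_mem_edges_iff, not_or] at hqe
    have hm0 : m ≠ 0 := by
      rintro rfl
      exact hqe.1 (hmq ▸ ha)
    have hmk : m ≠ k := by
      rintro rfl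
      refine hqe.2 ?_
      rw [← hmq, hkb, SimpleGraph.Dart.symm_symm]
      exact hb
    exact Or.inr (Or.inr (Or.inr ⟨hmq, by omega⟩))

end

end IsEar

lemma exists_pow_eq_symm [G.LocallyFinite] {a b : G.Dart} (hba : b.snd = a.fst) :
    ∃ k < G.degree a.fst, (R.next ^ k) a = b.symm :=
  R.exists_pow_lt_degree (e := b.symm) hba.symm

lemma index_pos {v : V} {C : G.Walk v v} (hC : C.IsCycle) {a b : G.Dart} (ha : a ∈ C.darts)
    (hb : b ∈ C.darts) {k : ℕ} (hkb : (R.next ^ k) a = b.symm) : 0 < k := by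
  refine Nat.pos_of_ne_zero fun h => ?_
  subst h
  exact SimpleGraph.Walk.symm_notMem_darts hC.edges_nodup hb (hkb ▸ ha)

namespace IsEar

variable {R} {v w₁ w₂ : V} {C : G.Walk v v} {P : G.Walk w₁ w₂} {p q : G.Dart}

lemma adj_of_mem_left {d : G.Dart} (hd : d ∈ C.darts) :
    (C.toSubgraph ⊔ P.toSubgraph).Adj d.fst d.snd :=
  adj_iff.2 (Or.inl (Or.inl hd))

lemma adj_of_mem_right {d : G.Dart} (hd : d ∈ P.darts) :
    (C.toSubgraph ⊔ P.toSubgraph).Adj d.fst d.snd :=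
  adj_iff.2 (Or.inr (Or.inl hd))

lemma connected (h : IsEar C P p q) : (C.toSubgraph ⊔ P.toSubgraph).Connected :=
  SimpleGraph.Subgraph.connected_sup C.toSubgraph_connected.preconnected
    P.toSubgraph_connected.preconnected ⟨w₁, by simpa using h.start_mem, by simp⟩

lemma verts_finite : (C.toSubgraph ⊔ P.toSubgraph).verts.Finite := by
  rw [SimpleGraph.Subgraph.verts_sup, SimpleGraph.Walk.verts_toSubgraph,
    SimpleGraph.Walk.verts_toSubgraph]
  exact C.support.finite_toSet.union P.support.finite_toSet

lemma edgeSet_eq : (C.toSubgraph ⊔ P.toSubgraph).edgeSet = {e | e ∈ C.edges ++ P.edges} := by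
  ext e
  simp [SimpleGraph.Subgraph.edgeSet_sup]

lemma le_ncard_edgeSet (h : IsEar C P p q) (hC : C.IsCycle) :
    C.length + P.length ≤ (C.toSubgraph ⊔ P.toSubgraph).edgeSet.ncard := by
  classical
  have hnd : (C.edges ++ P.edges).Nodup := List.nodup_append'.2
    ⟨hC.edges_nodup, h.edges_nodup, fun e he he' => h.edges_disjoint e he' he⟩
  rw [edgeSet_eq, ← List.coe_toFinset, Set.ncard_coe_finset,
    List.toFinset_card_of_nodup hnd, List.length_append, SimpleGraph.Walk.length_edges,
    SimpleGraph.Walk.length_edges]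

/-- Each vertex of the union is the head of a dart of `C`, or of a dart of `P` other than the
last. -/
lemma ncard_verts_lt (h : IsEar C P p q) (hC : C.IsCycle) :
    (C.toSubgraph ⊔ P.toSubgraph).verts.ncard < C.length + P.length := by
  classical
  have hsub : (C.toSubgraph ⊔ P.toSubgraph).verts ⊆
      ((C.darts.toFinset.image (·.snd)) ∪ ((P.darts.toFinset.erase q.symm).image (·.snd)) :
        Finset V) := by
    have hCs : ∀ x ∈ C.support, x ∈ C.darts.toFinset.image (·.snd) := fun x hx => by
      obtain ⟨b, hb, rfl⟩ := hC.exists_dart_snd hx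
      exact Finset.mem_image_of_mem _ (List.mem_toFinset.2 hb)
    intro x hx
    rw [SimpleGraph.Subgraph.verts_sup, SimpleGraph.Walk.verts_toSubgraph,
      SimpleGraph.Walk.verts_toSubgraph] at hx
    rw [Finset.mem_coe, Finset.mem_union]
    rcases hx with hx | hx
    · exact Or.inl (hCs x hx)
    · rw [Set.mem_ofPred_eq, ← SimpleGraph.Walk.cons_map_snd_darts, List.mem_cons,
        List.mem_map] at hx
      rcases hx with rfl | ⟨d, hd, rfl⟩
      · exact Or.inl (hCs _ h.start_mem)
      · by_cases hdq : d = q.symm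
        · refine Or.inl (hCs _ ?_)
          rw [hdq]
          change q.fst ∈ _
          rw [h.q_fst]
          exact h.end_mem
        · exact Or.inr (Finset.mem_image_of_mem _
            (Finset.mem_erase.2 ⟨hdq, List.mem_toFinset.2 hd⟩))
  have h1 := Set.ncard_le_ncard hsub (Finset.finite_toSet _)
  rw [Set.ncard_coe_finset] at h1
  have h2 : (C.darts.toFinset.image (·.snd)).card ≤ C.length :=
    Finset.card_image_le.trans ((List.toFinset_card_le _).trans (by simp))
  have hq := List.mem_toFinset.2 h.q_mem
  have h3 : ((P.darts.toFinset.erase q.symm).image (·.snd)).card < P.length :=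
    Finset.card_image_le.trans_lt ((Finset.card_erase_lt_of_mem hq).trans_le
      ((List.toFinset_card_le _).trans (by simp)))
  have h4 := Finset.card_union_le (C.darts.toFinset.image (·.snd))
    ((P.darts.toFinset.erase q.symm).image (·.snd))
  omega

section

variable [G.LocallyFinite]

/-- Consecutive darts of `C` lie on the same face (on the left of `C`) unless the ear returns
between them. -/
lemma face_cycle (h : IsEar C P p q) (hC : C.IsCycle) (hp : R.IsInnerDart C p)
    (hq : ¬ R.IsInnerDart C q) {a b : G.Dart} (ha : a ∈ C.darts) (hb : b ∈ C.darts)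
    (hba : b.snd = a.fst) (hx : a.fst ≠ w₂)
    (hb' : (C.toSubgraph ⊔ P.toSubgraph).Adj b.fst b.snd)
    (ha' : (C.toSubgraph ⊔ P.toSubgraph).Adj a.fst a.snd) :
    Quot.mk (R.FaceStep _) ⟨b, hb'⟩ = Quot.mk (R.FaceStep _) ⟨a, ha'⟩ := by
  obtain ⟨k, hk, hkb⟩ := R.exists_pow_eq_symm hba
  refine R.quot_mk_eq_of_pow hk hkb (R.pow_degree a) (fun m hkm hm hadj => ?_) _ _
  rcases h.index_cases hC hp hq ha hb hba hk hkb hm hadj with h1 | h1 | h1 | h1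
  · omega
  · omega
  · omega
  · exact hx (by rw [← h.q_fst, ← h1.1, R.pow_next_fst])

/-- Consecutive darts against `C` lie on the same face (on the right of `C`) unless the ear starts
between them. -/
lemma face_cycle_symm (h : IsEar C P p q) (hC : C.IsCycle) (hp : R.IsInnerDart C p)
    (hq : ¬ R.IsInnerDart C q) {a b : G.Dart} (ha : a ∈ C.darts) (hb : b ∈ C.darts)
    (hba : b.snd = a.fst) (hx : a.fst ≠ w₁)
    (ha' : (C.toSubgraph ⊔ P.toSubgraph).Adj a.symm.fst a.symm.snd)
    (hb' : (C.toSubgraph ⊔ P.toSubgraph).Adj b.symm.fst b.symm.snd) :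
    Quot.mk (R.FaceStep _) ⟨a.symm, ha'⟩ = Quot.mk (R.FaceStep _) ⟨b.symm, hb'⟩ := by
  obtain ⟨k, hk, hkb⟩ := R.exists_pow_eq_symm hba
  refine R.quot_mk_eq_of_pow (a := a) (i := 0) (R.index_pos hC ha hb hkb) (by simp) hkb
    (fun m hm hmk hadj => ?_) _ _
  rcases h.index_cases hC hp hq ha hb hba hk hkb (hmk.trans hk) hadj with h1 | h1 | h1 | h1
  · omega
  · omega
  · exact hx (by rw [← h.p_fst, ← h1.1, R.pow_next_fst])
  · omega

/-- The face along the ear, followed to its end, goes on along `C`: the ear arrives from the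
left. -/
lemma face_ear_end (h : IsEar C P p q) (hC : C.IsCycle) (hp : R.IsInnerDart C p)
    (hq : ¬ R.IsInnerDart C q) {a : G.Dart} (ha : a ∈ C.darts) (haf : a.fst = w₂)
    (hq' : (C.toSubgraph ⊔ P.toSubgraph).Adj q.symm.fst q.symm.snd)
    (ha' : (C.toSubgraph ⊔ P.toSubgraph).Adj a.fst a.snd) :
    Quot.mk (R.FaceStep _) ⟨q.symm, hq'⟩ = Quot.mk (R.FaceStep _) ⟨a, ha'⟩ := by
  obtain ⟨b, hb, hbs⟩ := hC.exists_dart_snd h.end_mem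
  have hba := hbs.trans haf.symm
  obtain ⟨k, hk, hkb⟩ := R.exists_pow_eq_symm hba
  obtain ⟨l, hl, hlq⟩ := R.exists_pow_lt_degree (haf.trans h.q_fst.symm)
  have hk0 := R.index_pos hC ha hb hkb
  have hkl : k ≤ l := by
    have h1 := h.index_cases hC hp hq ha hb hba hk hkb hl (by
      rw [hlq]
      exact adj_iff.2 (Or.inr (Or.inr h.q_mem)))
    have h2 := mt (R.isInnerDart_iff hC ha hb hba hk hkb hl hlq).2 hq
    have h3 : l ≠ 0 := by
      rintro rfl
      refine h.edges_disjoint q.edge (SimpleGraph.Walk.edge_mem_edges_iff.2 (Or.inr h.q_mem)) ?_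
      exact SimpleGraph.Walk.edge_mem_edges_iff.2 (Or.inl (hlq ▸ ha))
    omega
  refine R.quot_mk_eq_of_pow hl (by simpa using hlq) (R.pow_degree a)
    (fun m hlm hm hadj => ?_) _ _
  rcases h.index_cases hC hp hq ha hb hba hk hkb hm hadj with h1 | h1 | h1 | h1
  · omega
  · omega
  · omega
  · have := R.pow_next_inj hm hl (h1.1.trans hlq.symm)
    omega

/-- The face against the ear, followed back to its start, goes on against `C`: the ear leaves to
the right. -/
lemma face_ear_start (h : IsEar C P p q) (hC : C.IsCycle) (hp : R.IsInnerDart C p)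
    (hq : ¬ R.IsInnerDart C q) {b : G.Dart} (hb : b ∈ C.darts) (hbs : b.snd = w₁)
    (hp' : (C.toSubgraph ⊔ P.toSubgraph).Adj p.symm.fst p.symm.snd)
    (hb' : (C.toSubgraph ⊔ P.toSubgraph).Adj b.symm.fst b.symm.snd) :
    Quot.mk (R.FaceStep _) ⟨p.symm, hp'⟩ = Quot.mk (R.FaceStep _) ⟨b.symm, hb'⟩ := by
  obtain ⟨a, ha, haf⟩ := hC.exists_dart_fst h.start_mem
  have hba := hbs.trans haf.symm
  obtain ⟨k, hk, hkb⟩ := R.exists_pow_eq_symm hba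
  obtain ⟨i, hi, hip⟩ := R.exists_pow_lt_degree (haf.trans h.p_fst.symm)
  have hik := (R.isInnerDart_iff hC ha hb hba hk hkb hi hip).1 hp
  refine R.quot_mk_eq_of_pow hik.2 (by simpa using hip) hkb (fun m him hmk hadj => ?_) _ _
  rcases h.index_cases hC hp hq ha hb hba hk hkb (hmk.trans hk) hadj with h1 | h1 | h1 | h1
  · omega
  · omega
  · have := R.pow_next_inj (hmk.trans hk) hi (h1.1.trans hip.symm)
    omega
  · omega

lemma face_interior (h : IsEar C P p q) {d e : G.Dart} (hd : d ∈ P.darts) (he : e ∈ P.darts)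
    (hde : d.snd = e.fst) (hx : e.fst ∉ C.support)
    (hd' : (C.toSubgraph ⊔ P.toSubgraph).Adj d.fst d.snd)
    (he' : (C.toSubgraph ⊔ P.toSubgraph).Adj e.fst e.snd) :
    Quot.mk (R.FaceStep _) ⟨d, hd'⟩ = Quot.mk (R.FaceStep _) ⟨e, he'⟩ := by
  obtain ⟨j, hj, hje⟩ := R.exists_pow_lt_degree (d := d.symm) (e := e) hde
  have hj0 : 0 < j := by
    refine Nat.pos_of_ne_zero fun h0 => ?_
    subst h0
    exact SimpleGraph.Walk.symm_notMem_darts h.edges_nodup hd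
      (show (R.next ^ 0) d.symm ∈ P.darts from hje ▸ he)
  refine R.quot_mk_eq_of_pow (a := d.symm) (i := 0) hj0 (by simp) hje
    (fun m hm hmj hadj => ?_) _ _
  rcases h.index_cases_interior hd he hde hx hde m hadj with h1 | h1
  · have := R.pow_next_inj (hmj.trans hj) hj (h1.trans hje.symm)
    omega
  · have : (R.next ^ m) d.symm = (R.next ^ 0) d.symm := h1
    have := R.pow_next_inj (hmj.trans hj) (by omega) this
    omega

lemma face_interior_symm (h : IsEar C P p q) {d e : G.Dart} (hd : d ∈ P.darts)
    (he : e ∈ P.darts) (hde : d.snd = e.fst) (hx : e.fst ∉ C.support)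
    (he' : (C.toSubgraph ⊔ P.toSubgraph).Adj e.symm.fst e.symm.snd)
    (hd' : (C.toSubgraph ⊔ P.toSubgraph).Adj d.symm.fst d.symm.snd) :
    Quot.mk (R.FaceStep _) ⟨e.symm, he'⟩ = Quot.mk (R.FaceStep _) ⟨d.symm, hd'⟩ := by
  obtain ⟨j, hj, hjd⟩ := R.exists_pow_eq_symm hde
  have hj0 : 0 < j := by
    refine Nat.pos_of_ne_zero fun h0 => ?_
    subst h0
    exact SimpleGraph.Walk.symm_notMem_darts h.edges_nodup hd (hjd ▸ he)
  refine R.quot_mk_eq_of_pow (a := e) (i := 0) hj0 (by simp) hjd (fun m hm hmj hadj => ?_) _ _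
  rcases h.index_cases_interior hd he hde hx rfl m hadj with h1 | h1
  · have : (R.next ^ m) e = (R.next ^ 0) e := h1
    have := R.pow_next_inj (hmj.trans hj) (by omega) this
    omega
  · have := R.pow_next_inj (hmj.trans hj) hj (h1.trans hjd.symm)
    omega

/-- All darts of `C` and `P` lie on one face, and all their reverses lie on one face. The darts of
`C` follow each other on a face except possibly at `w₂`, so that going round `C` from `w₂` they are
all on the same face; the reverses are treated in the same way from `w₁`. -/
lemma numFaces_le_two (h : IsEar C P p q) (hC : C.IsCycle) (hp : R.IsInnerDart C p)
    (hq : ¬ R.IsInnerDart C q) : R.numFaces (C.toSubgraph ⊔ P.toSubgraph) ≤ 2 := by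
  classical
  obtain ⟨a, ha, haf⟩ := hC.exists_dart_fst h.end_mem
  obtain ⟨b, hb, hbs⟩ := hC.exists_dart_snd h.start_mem
  have ha' : (C.toSubgraph ⊔ P.toSubgraph).Adj a.fst a.snd := adj_of_mem_left ha
  have hb' : (C.toSubgraph ⊔ P.toSubgraph).Adj b.symm.fst b.symm.snd :=
    (adj_of_mem_left hb).symm
  set c₁ := Quot.mk (R.FaceStep (C.toSubgraph ⊔ P.toSubgraph)) ⟨a, ha'⟩
  set c₂ := Quot.mk (R.FaceStep (C.toSubgraph ⊔ P.toSubgraph)) ⟨b.symm, hb'⟩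
  have hCf : ∀ d ∈ C.darts, ∀ hd : (C.toSubgraph ⊔ P.toSubgraph).Adj d.fst d.snd,
      Quot.mk (R.FaceStep _) ⟨d, hd⟩ = c₁ := by
    have hrot : ∀ {d : G.Dart}, d ∈ (C.rotate w₂ h.end_mem).darts ↔ d ∈ C.darts :=
      (C.rotate_darts w₂ h.end_mem).perm.mem_iff
    have := (C.rotate w₂ h.end_mem).forall_mem_darts_of_step (Q := fun d =>
      ∀ hd : (C.toSubgraph ⊔ P.toSubgraph).Adj d.fst d.snd, Quot.mk (R.FaceStep _) ⟨d, hd⟩ = c₁)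
      (fun d hd hdf _ => by
        have hda : d = a := hC.dart_eq_of_fst (hrot.1 hd) ha (hdf.trans haf.symm)
        subst hda
        rfl)
      (fun d hd e he hde hQ he' => by
        by_cases hx : e.fst = w₂
        · have hea : e = a := hC.dart_eq_of_fst (hrot.1 he) ha (hx.trans haf.symm)
          subst hea
          rfl
        · have hd' := adj_of_mem_left (P := P) (hrot.1 hd)
          rw [← hQ hd']
          exact (h.face_cycle hC hp hq (hrot.1 he) (hrot.1 hd) hde hx _ _).symm)
    exact fun d hd => this d (hrot.2 hd)
  have hCb : ∀ d ∈ C.darts,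
      ∀ hd : (C.toSubgraph ⊔ P.toSubgraph).Adj d.symm.fst d.symm.snd,
      Quot.mk (R.FaceStep _) ⟨d.symm, hd⟩ = c₂ := by
    have hw : w₁ ∈ C.reverse.support := by simpa using h.start_mem
    have hrot : ∀ {d : G.Dart}, d ∈ (C.reverse.rotate w₁ hw).darts ↔ d.symm ∈ C.darts := fun {d} =>
      (C.reverse.rotate_darts w₁ hw).perm.mem_iff.trans SimpleGraph.Walk.mem_darts_reverse
    have hQb : ∀ d, d.symm ∈ C.darts → d.fst = w₁ → d = b.symm := fun d hd hdf => by
      rw [← hC.dart_eq_of_snd hd hb (hdf.trans hbs.symm), SimpleGraph.Dart.symm_symm]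
    have := (C.reverse.rotate w₁ hw).forall_mem_darts_of_step (Q := fun d =>
      ∀ hd : (C.toSubgraph ⊔ P.toSubgraph).Adj d.fst d.snd, Quot.mk (R.FaceStep _) ⟨d, hd⟩ = c₂)
      (fun d hd hdf _ => by
        obtain rfl := hQb d (hrot.1 hd) hdf
        rfl)
      (fun d hd e he hde hQ he' => by
        by_cases hx : e.fst = w₁
        · obtain rfl := hQb e (hrot.1 he) hx
          rfl
        · have hd' := (adj_of_mem_left (P := P) (hrot.1 hd)).symm
          rw [← hQ hd']
          refine (h.face_cycle_symm hC hp hq (hrot.1 hd) (hrot.1 he) hde.symm ?_ hd' he').symm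
          exact fun h0 => hx (hde.symm.trans h0))
    exact fun d hd => this d.symm (hrot.2 (by simpa using hd))
  have hp' := adj_of_mem_right (C := C) h.p_mem
  have hq' := adj_of_mem_right (C := C) h.q_mem
  have hPf : ∀ d ∈ P.darts, ∀ hd : (C.toSubgraph ⊔ P.toSubgraph).Adj d.fst d.snd,
      Quot.mk (R.FaceStep _) ⟨d, hd⟩ = c₁ := by
    have := P.forall_mem_darts_of_step (Q := fun d =>
      ∀ hd : (C.toSubgraph ⊔ P.toSubgraph).Adj d.fst d.snd,
        Quot.mk (R.FaceStep _) ⟨d, hd⟩ = Quot.mk (R.FaceStep _) ⟨p, hp'⟩)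
      (fun d hd hdf _ => by
        obtain rfl := h.eq_p d hd (hdf ▸ h.start_mem)
        rfl)
      (fun d hd e he hde hQ he' => by
        by_cases hx : e.fst ∈ C.support
        · obtain rfl := h.eq_p e he hx
          rfl
        · have hd' := adj_of_mem_right (C := C) hd
          rw [← hQ hd']
          exact (h.face_interior hd he hde hx _ _).symm)
    intro d hd hd'
    rw [this d hd hd', ← this _ h.q_mem hq']
    exact h.face_ear_end hC hp hq ha haf _ _
  have hPb : ∀ d ∈ P.darts,
      ∀ hd : (C.toSubgraph ⊔ P.toSubgraph).Adj d.symm.fst d.symm.snd,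
      Quot.mk (R.FaceStep _) ⟨d.symm, hd⟩ = c₂ := by
    have := P.forall_mem_darts_of_step (Q := fun d =>
      ∀ hd : (C.toSubgraph ⊔ P.toSubgraph).Adj d.symm.fst d.symm.snd,
        Quot.mk (R.FaceStep _) ⟨d.symm, hd⟩ = c₂)
      (fun d hd hdf _ => by
        obtain rfl := h.eq_p d hd (hdf ▸ h.start_mem)
        exact h.face_ear_start hC hp hq hb hbs _ _)
      (fun d hd e he hde hQ he' => by
        by_cases hx : e.fst ∈ C.support
        · obtain rfl := h.eq_p e he hx
          exact h.face_ear_start hC hp hq hb hbs _ _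
        · have hd' := (adj_of_mem_right (C := C) hd).symm
          rw [← hQ hd']
          exact h.face_interior_symm hd he hde hx _ _)
    exact this
  have hsurj : Function.Surjective (fun t : Bool => cond t c₁ c₂) := by
    intro z
    obtain ⟨⟨d, hd⟩, rfl⟩ := Quot.exists_rep z
    rcases adj_iff.1 hd with (h1 | h1) | h1 | h1
    · exact ⟨true, (hCf d h1 hd).symm⟩
    · exact ⟨false, (hCb d.symm h1 hd).symm⟩
    · exact ⟨true, (hPf d h1 hd).symm⟩
    · exact ⟨false, (hPb d.symm h1 hd).symm⟩
  have := Nat.card_le_card_of_surjective _ hsurj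
  simpa [numFaces] using this

/-- Jordan curve theorem: an ear that leaves `C` to the right also comes back from the right.
Otherwise the cycle and the ear together have at most two faces (one along `C` and one against
it), and more edges than vertices, in contradiction to Euler's formula. -/
theorem isInnerDart (hR : R.IsPlanar) (h : IsEar C P p q) (hC : C.IsCycle)
    (hp : R.IsInnerDart C p) : R.IsInnerDart C q := by
  by_contra hq
  have hne : (C.toSubgraph ⊔ P.toSubgraph).edgeSet.Nonempty :=
    ⟨p.edge, adj_of_mem_right h.p_mem⟩
  have h1 := hR _ verts_finite h.connected hne
  have h2 := h.numFaces_le_two hC hp hq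
  have h3 := h.le_ncard_edgeSet hC
  have h4 := h.ncard_verts_lt hC
  omega

end

end IsEar

end RotationSystem

/-! ### Darts that join the inside of a cycle to the cycle -/

namespace RotationSystem

variable {V : Type*} {G : SimpleGraph V} {R : RotationSystem G}

lemma Inside.notMem {v : V} {C : G.Walk v v} {u : V} (hu : R.Inside C u) : u ∉ C.support := by
  cases hu with
  | enter d _ h => exact h
  | step _ _ _ _ h => exact h

/-- A site inside `C` is joined to the head of an inner dart by a walk that avoids `C`. -/
lemma Inside.exists_walk {v : V} {C : G.Walk v v} {u : V} (hu : R.Inside C u) :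
    ∃ p : G.Dart, R.IsInnerDart C p ∧ ∃ Q : G.Walk p.snd u, ∀ z ∈ Q.support, z ∉ C.support := by
  induction hu with
  | enter d hd hds => exact ⟨d, hd, .nil, by simpa using hds⟩
  | step u w _ huw hw ih =>
    obtain ⟨p, hp, Q, hQ⟩ := ih
    refine ⟨p, hp, Q.concat huw, fun z hz => ?_⟩
    rw [SimpleGraph.Walk.support_concat, List.mem_append,
      List.mem_singleton] at hz
    rcases hz with hz | rfl
    · exact hQ z hz
    · exact hw

variable [G.LocallyFinite] {v : V} {C : G.Walk v v}

/-- A chord of the cycle that leaves it to the right also comes back from the right. -/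
lemma IsInnerDart.symm (hR : R.IsPlanar) (hC : C.IsCycle) {d : G.Dart} (hd : R.IsInnerDart C d)
    (hds : d.snd ∈ C.support) : R.IsInnerDart C d.symm := by
  have hear : IsEar C (SimpleGraph.Walk.cons d.adj .nil) d d.symm :=
    { start_mem := hd.fst_mem
      end_mem := hds
      p_mem := by simp
      q_mem := by simp
      p_fst := rfl
      q_fst := rfl
      eq_p := fun e he _ => by simpa using he
      eq_q := fun e he _ => by
        have : e = d := by simpa using he
        rw [this]
      nodup_fst := by simp
      nodup_snd := by simp
      edges_nodup := by simp
      edges_disjoint := fun e he => by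
        have : e = d.edge := by simpa [SimpleGraph.Dart.edge] using he
        rw [this]
        exact hd.edge_notMem hC }
  exact hear.isInnerDart hR hC hd

/-- A dart from the cycle to a site inside it points to the right of the cycle. -/
lemma Inside.isInnerDart (hR : R.IsPlanar) (hC : C.IsCycle) {e : G.Dart}
    (hu : R.Inside C e.snd) (hef : e.fst ∈ C.support) : R.IsInnerDart C e := by
  classical
  obtain ⟨p, hp, Q₀, hQ₀⟩ := hu.exists_walk
  by_cases hpe : p = e
  · exact hpe ▸ hp
  obtain ⟨Q, hQp, hQ⟩ : ∃ Q : G.Walk p.snd e.snd, Q.IsPath ∧ ∀ z ∈ Q.support, z ∉ C.support :=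
    ⟨Q₀.bypass, Q₀.bypass_isPath, fun z hz => hQ₀ z (Q₀.support_bypass_subset_support hz)⟩
  have hpC := hp.fst_mem
  have hpQ : p.fst ∉ Q.support := fun h => hQ _ h hpC
  have heQ : e.fst ∉ Q.support := fun h => hQ _ h hef
  have hdarts : (SimpleGraph.Walk.cons p.adj (Q.concat e.adj.symm)).darts =
      p :: (Q.darts ++ [e.symm]) := by
    rw [SimpleGraph.Walk.darts_cons, SimpleGraph.Walk.darts_concat, List.concat_eq_append]
    rfl
  have hmem : ∀ d ∈ (SimpleGraph.Walk.cons p.adj (Q.concat e.adj.symm)).darts,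
      d = p ∨ d ∈ Q.darts ∨ d = e.symm := fun d hd => by
    rw [hdarts] at hd
    simpa using hd
  have hedges : (SimpleGraph.Walk.cons p.adj (Q.concat e.adj.symm)).edges =
      p.edge :: (Q.edges ++ [e.edge]) := by
    rw [SimpleGraph.Walk.edges, hdarts, List.map_cons, List.map_append]
    simp [SimpleGraph.Walk.edges]
  have hpeQ : p.edge ∉ Q.edges := fun h =>
    hpQ (Q.fst_mem_support_of_mem_edges h)
  have heeQ : e.edge ∉ Q.edges := fun h =>
    heQ (Q.fst_mem_support_of_mem_edges h)
  have hear : IsEar C (SimpleGraph.Walk.cons p.adj (Q.concat e.adj.symm)) p e :=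
    { start_mem := hpC
      end_mem := hef
      p_mem := by rw [hdarts]; simp
      q_mem := by rw [hdarts]; simp
      p_fst := rfl
      q_fst := rfl
      eq_p := fun d hd hdC => by
        rcases hmem d hd with h | h | rfl
        · exact h
        · exact absurd hdC (hQ _ (Q.dart_fst_mem_support_of_mem_darts h))
        · exact absurd hdC (hQ _ Q.end_mem_support)
      eq_q := fun d hd hdC => by
        rcases hmem d hd with rfl | h | rfl
        · exact absurd hdC (hQ _ Q.start_mem_support)
        · exact absurd hdC (hQ _ (Q.dart_snd_mem_support_of_mem_darts h))
        · exact e.symm_symm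
      nodup_fst := by
        have : ((SimpleGraph.Walk.cons p.adj (Q.concat e.adj.symm)).darts.map (·.fst)) =
            p.fst :: Q.support := by
          rw [hdarts, List.map_cons, List.map_append, ← Q.map_fst_darts_append]
          rfl
        rw [this]
        exact List.nodup_cons.2 ⟨hpQ, hQp.support_nodup⟩
      nodup_snd := by
        have : ((SimpleGraph.Walk.cons p.adj (Q.concat e.adj.symm)).darts.map (·.snd)) =
            Q.support ++ [e.fst] := by
          rw [hdarts, List.map_cons, List.map_append, ← Q.cons_map_snd_darts]
          rfl
        rw [this]
        refine List.nodup_append'.2 ⟨hQp.support_nodup, List.nodup_singleton _, ?_⟩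
        exact List.disjoint_singleton.2 heQ
      edges_nodup := by
        rw [hedges]
        refine List.nodup_cons.2 ⟨?_, List.nodup_append'.2 ⟨hQp.isTrail.edges_nodup,
          List.nodup_singleton _, List.disjoint_singleton.2 heeQ⟩⟩
        rw [List.mem_append, List.mem_singleton, not_or]
        refine ⟨hpeQ, fun h => ?_⟩
        rcases (SimpleGraph.dart_edge_eq_iff _ _).1 h with h | h
        · exact hpe h
        · refine hQ _ Q.end_mem_support ?_
          have : p.fst = e.snd := by rw [h]; rfl
          rwa [← this]
      edges_disjoint := fun f hf hfC => by
        rw [hedges, List.mem_cons, List.mem_append, List.mem_singleton] at hf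
        rcases hf with rfl | hf | rfl
        · exact hp.edge_notMem hC hfC
        · induction f with
          | _ x y =>
            exact hQ x (Q.fst_mem_support_of_mem_edges hf) (C.fst_mem_support_of_mem_edges hfC)
        · exact hQ _ Q.end_mem_support (C.snd_mem_support_of_mem_edges hfC) }
  exact hear.isInnerDart hR hC hp

/-! ### The budget of a clockwise contour -/

variable {ρ : RotorState G}

/-- The rotors on the contour turn from their position along `C` to the one against `C`, those
inside make at most one full turn. -/
structure IsContourBudget (R : RotationSystem G) (ρ : RotorState G) (C : G.Walk v v)
    (N : V → ℕ) : Prop where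
  lt_degree : ∀ u ∈ C.support, N u < G.degree u
  symm_mem : ∀ u ∈ C.support, ((R.next ^ N u) (ρ.dart u)).symm ∈ C.darts
  eq_degree : ∀ u ∉ C.support, N u = G.degree u

namespace IsClockwiseContour

lemma exists_isContourBudget (hC : R.IsClockwiseContour ρ C) :
    ∃ N, IsContourBudget R ρ C N := by
  have hex : ∀ u, ∃ n, (u ∈ C.support →
      n < G.degree u ∧ ((R.next ^ n) (ρ.dart u)).symm ∈ C.darts) ∧
      (u ∉ C.support → n = G.degree u) := by
    intro u
    by_cases hu : u ∈ C.support
    · obtain ⟨b, hb, hbs⟩ := hC.isCycle.exists_dart_snd hu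
      obtain ⟨k, hk, hkb⟩ := R.exists_pow_eq_symm (hbs.trans (ρ.dart_fst u).symm)
      rw [ρ.dart_fst] at hk
      exact ⟨k, fun _ => ⟨hk, by rwa [hkb, SimpleGraph.Dart.symm_symm]⟩, fun h => absurd hu h⟩
    · exact ⟨_, fun h => absurd h hu, fun _ => rfl⟩
  choose N hN using hex
  exact ⟨N, fun u hu => ((hN u).1 hu).1, fun u hu => ((hN u).1 hu).2, fun u hu => (hN u).2 hu⟩

variable {N : V → ℕ}

lemma isInnerDart_iff (hC : R.IsClockwiseContour ρ C) (hN : IsContourBudget R ρ C N) {x : V}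
    (hx : x ∈ C.support) {i : ℕ} (hi : i < G.degree x) :
    R.IsInnerDart C ((R.next ^ i) (ρ.dart x)) ↔ 0 < i ∧ i < N x :=
  R.isInnerDart_iff hC.isCycle (hC.arrows x hx) (hN.symm_mem x hx)
    (R.pow_next_fst _ _) (by rw [ρ.dart_fst]; exact hN.lt_degree x hx)
    (SimpleGraph.Dart.symm_symm _).symm (by rwa [ρ.dart_fst]) rfl

lemma budget_pos (hC : R.IsClockwiseContour ρ C) (hN : IsContourBudget R ρ C N) {x : V}
    (hx : x ∈ C.support) : 0 < N x :=
  R.index_pos hC.isCycle (hC.arrows x hx) (hN.symm_mem x hx) (SimpleGraph.Dart.symm_symm _).symm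

/-- A rotor on the contour points against the contour only when its budget is used up. -/
lemma eq_budget (hC : R.IsClockwiseContour ρ C) (hN : IsContourBudget R ρ C N) {x : V}
    (hx : x ∈ C.support) {i : ℕ} (hi : i ≤ N x)
    (his : ((R.next ^ i) (ρ.dart x)).symm ∈ C.darts) : i = N x := by
  have h : ((R.next ^ i) (ρ.dart x)).symm = ((R.next ^ N x) (ρ.dart x)).symm :=
    hC.isCycle.dart_eq_of_snd his (hN.symm_mem x hx)
      ((R.pow_next_fst _ _).trans (R.pow_next_fst _ _).symm)
  have hlt := hN.lt_degree x hx
  exact R.pow_next_inj (by rw [ρ.dart_fst]; omega) (by rw [ρ.dart_fst]; omega)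
    (SimpleGraph.Dart.symm_involutive.injective h)

/-- By the Jordan curve theorem, the budget of the contour confines the chip to the contour and
its inside. -/
lemma isBudget (hR : R.IsPlanar) (hC : R.IsClockwiseContour ρ C) (hN : IsContourBudget R ρ C N)
    {S : Finset V} (hS : ∀ u, u ∈ S ↔ R.Inside C u ∨ u ∈ C.support) : R.IsBudget ρ S N := by
  have hcyc := hC.isCycle
  have key : ∀ u ∈ S, ∀ j, 0 < j → j ≤ N u → ((R.next ^ j) (ρ.dart u)).snd ∈ S ∧
      ∃ i < N ((R.next ^ j) (ρ.dart u)).snd,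
        (R.next ^ i) (ρ.dart ((R.next ^ j) (ρ.dart u)).snd) =
          ((R.next ^ j) (ρ.dart u)).symm := by
    intro u hu j hj0 hj
    have hfst : ((R.next ^ j) (ρ.dart u)).fst = u := by rw [R.pow_next_fst, ρ.dart_fst]
    generalize hd : (R.next ^ j) (ρ.dart u) = d at hfst
    obtain ⟨i, hi, hid⟩ := R.exists_pow_lt_degree (d := ρ.dart d.snd) (e := d.symm)
      (ρ.dart_fst d.snd)
    rw [ρ.dart_fst] at hi
    have hinner : d.snd ∈ C.support → R.IsInnerDart C d.symm → d.snd ∈ S ∧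
        ∃ i < N d.snd, (R.next ^ i) (ρ.dart d.snd) = d.symm := fun hx hdi =>
      ⟨(hS _).2 (Or.inr hx), i, ((hC.isInnerDart_iff hN hx hi).1 (hid ▸ hdi)).2, hid⟩
    have hinside : R.Inside C d.snd → d.snd ∈ S ∧
        ∃ i < N d.snd, (R.next ^ i) (ρ.dart d.snd) = d.symm := fun hx =>
      ⟨(hS _).2 (Or.inl hx), i, by rwa [hN.eq_degree _ hx.notMem], hid⟩
    rcases (hS u).1 hu with hu | hu
    · by_cases hx : d.snd ∈ C.support
      · refine hinner hx (Inside.isInnerDart hR hcyc ?_ hx)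
        change R.Inside C d.fst
        rwa [hfst]
      · exact hinside (.step u _ hu (hfst ▸ d.adj) hx)
    · have hlt := hN.lt_degree u hu
      rcases hj.lt_or_eq with hjN | rfl
      · have hdi : R.IsInnerDart C d := hd ▸ (hC.isInnerDart_iff hN hu (hj.trans_lt hlt)).2
          ⟨hj0, hjN⟩
        by_cases hx : d.snd ∈ C.support
        · exact hinner hx (hdi.symm hR hcyc hx)
        · exact hinside (.enter d hdi hx)
      · have hds : d.symm ∈ C.darts := hd ▸ hN.symm_mem u hu
        have hx : d.snd ∈ C.support := C.dart_fst_mem_support_of_mem_darts hds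
        exact ⟨(hS _).2 (Or.inr hx), 0, hC.budget_pos hN hx,
          hcyc.dart_eq_of_fst (hC.arrows _ hx) hds (ρ.dart_fst _)⟩
  refine ⟨fun u _ => ?_, fun u hu j hj0 hj => (key u hu j hj0 hj).1,
    fun u hu j hj0 hj => (key u hu j hj0 hj).2⟩
  by_cases hu : u ∈ C.support
  · exact (hN.lt_degree u hu).le
  · exact (hN.eq_degree u hu).le

end IsClockwiseContour

end RotationSystem

/-! ### Reversal of the contour -/

theorem mainTheorem1 {V : Type*} [DecidableEq V] (G : SimpleGraph V) [G.LocallyFinite]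
    (R : RotationSystem G) (hR : R.IsPlanar) (ρ : RotorState G) (v : V) (C : G.Walk v v)
    (hC : R.IsClockwiseContour ρ C) :
    ∃ T : ℕ, R.IsReturnTime ρ C T ∧
      ∀ u ∈ R.forestRootedAt ρ C, R.numRotations ρ v T u = G.degree u := by
  obtain ⟨N, hN⟩ := hC.exists_isContourBudget
  have hv : v ∈ C.support := C.start_mem_support
  have hS : ∀ u, u ∈ hC.finite_inside.toFinset ∪ C.support.toFinset ↔
      R.Inside C u ∨ u ∈ C.support := fun u => by simp
  generalize hC.finite_inside.toFinset ∪ C.support.toFinset = S at hS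
  have hB := hC.isBudget hR hN hS
  obtain ⟨T, hpos, hTv, hlt, hle, hin⟩ := hB.exists_exhaustion ((hS v).2 (Or.inr hv))
  refine ⟨T, ⟨⟨?_, hpos, ?_⟩, ?_⟩, ?_⟩
  · refine Nat.pos_of_ne_zero fun h0 => ?_
    subst h0
    exact (hC.budget_pos hN hv).ne hTv
  · rw [R.walk_dart, hTv]
    exact hN.symm_mem v hv
  · rintro t ⟨-, htv, hts⟩
    by_contra! htT
    have h1 := hlt t htT
    rw [htv] at h1
    rw [R.walk_dart] at hts
    exact h1.ne (hC.eq_budget hN hv h1.le hts)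
  · -- the dart by which the next site of `C` points back is its last one within the budget
    have hcont : ∀ x ∈ C.support, R.numRotations ρ v T x = N x := by
      refine C.forall_mem_support_of_step hTv fun d hd hdx => ?_
      have hx := C.dart_fst_mem_support_of_mem_darts hd
      have hy := C.dart_snd_mem_support_of_mem_darts hd
      have hρ : ρ.dart d.fst = d :=
        hC.isCycle.dart_eq_of_fst (hC.arrows _ hx) hd (ρ.dart_fst _)
      obtain ⟨j, -, hj, hjd⟩ := hin _ hdx 0 (hC.budget_pos hN hx)
      rw [pow_zero, Equiv.Perm.one_apply, hρ] at hj hjd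
      refine (hle _).antisymm ?_
      rw [← hC.eq_budget hN hy (hj.trans (hle _)) (by rwa [hjd, SimpleGraph.Dart.symm_symm])]
      exact hj
    -- a site inside `C` is full if the target of its arrow is: its arrow is its last dart
    have hforest : ∀ n : ℕ, ∀ u, R.Inside C u ∨ u ∈ C.support → ρ.target^[n] u ∈ C.support →
        R.numRotations ρ v T u = N u := by
      intro n
      induction n with
      | zero => exact fun u _ hu => hcont u hu
      | succ n ih =>
        intro u hu hn
        by_cases huC : u ∈ C.support
        · exact hcont u huC
        have hui := hu.resolve_right huC
        have hadj : G.Adj u (ρ.target u) := by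
          have := (ρ.dart u).adj
          rwa [ρ.dart_fst] at this
        have hw := ih (ρ.target u) (by
          by_cases hw : ρ.target u ∈ C.support
          · exact Or.inr hw
          · exact Or.inl (.step u _ hui hadj hw)) hn
        have hNu := hN.eq_degree u huC
        have hpow : (R.next ^ N u) (ρ.dart u) = ρ.dart u := by
          have := R.pow_degree (ρ.dart u)
          rwa [ρ.dart_fst, ← hNu] at this
        have hN0 : 0 < N u := by
          rw [hNu]
          exact (G.degree_pos_iff_exists_adj u).2 ⟨_, hadj⟩
        obtain ⟨i, hi, hid⟩ := hB.symm_eq u ((hS u).2 hu) _ hN0 le_rfl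
        rw [hpow] at hi hid
        obtain ⟨j, hj0, hj, hjd⟩ := hin _ hw i hi
        have hsnd : ((R.next ^ i) (ρ.dart (ρ.target u))).snd = u := by
          change (R.next ^ i) (ρ.dart (ρ.target u)) = _ at hid
          rw [hid]
          exact ρ.dart_fst u
        change (R.next ^ i) (ρ.dart (ρ.target u)) = _ at hid
        rw [hsnd] at hj hjd
        rw [hid, SimpleGraph.Dart.symm_symm] at hjd
        have hjN : j ≤ N u := hj.trans (hle u)
        have := R.pow_next_inj' hj0 hN0 (by rw [ρ.dart_fst, ← hNu]; exact hjN)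
          (by rw [ρ.dart_fst, hNu]) (hjd.trans hpow.symm)
        exact (hle u).antisymm (this ▸ hj)
    rintro u ⟨hu, n, hn⟩
    rw [hforest n u (Or.inl hu) hn, hN.eq_degree u hu.notMem]
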